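/- **Theorem 8.10 (Brown–Adams representability).** Let $k$ be a commutative ring and let $\mathcal T$ be a $k$-linear triangulated category admitting arbitrary set-indexed coproducts. Let $\mathcal T^c\subseteq\mathcal T$ be the full subcategory of compact objects, i.e. of those $C$ for which $\operatorname{Hom}_{\mathcal T}(C,-)$ preserves coproducts, and assume that $\mathcal T^c$ has a skeleton with only countably many morphisms. Call a $k$-linear functor $H\colon(\mathcal T^c)^{\mathrm{op}}\to\operatorname{Mod}k$ cohomological if for every distinguished triangle $X\to Y\to Z\to\Sigma X$ with $X,Y,Z\in\mathcal T^c$ the sequence $H(Z)\to H(Y)\to H(X)$ is exact. Then: 1. For every cohomological functor $H\colon(\mathcal T^c)^{\mathrm{op}}\to\operatorname{Mod}k$ there are an object $X\in\mathcal T$ and a natural isomorphism $\mathcal T(-,X)|_{\mathcal T^c}\cong H$. 2. For every natural transformation $\alpha\colon H\to H'$ between cohomological functors $H,H'\colon(\mathcal T^c)^{\mathrm{op}}\to\operatorname{Mod}k$ there are a morphism $f\colon X\to X'$ of $\mathcal T$ and natural isomorphisms $e\colon\mathcal T(-,X)|_{\mathcal T^c}\to H$ and $e'\colon\mathcal T(-,X')|_{\mathcal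 T^c}\to H'$ such that $\alpha\circ e=e'\circ\mathcal T(-,f)|_{\mathcal T^c}$. -/

import Mathlib

open CategoryTheory CategoryTheory.Limits CategoryTheory.Pretriangulated Opposite

universe w v u

namespace BrownAdams

/-- The compact objects of a preadditive category `T`: the objects `C` such that the functor
`Hom(C, -)`, with values in abelian groups, preserves small coproducts. -/
def compactObjects (T : Type u) [Category.{v} T] [Preadditive T] : ObjectProperty T :=
  fun C => ∀ J : Type v,
    PreservesColimitsOfShape (Discrete J) (preadditiveCoyoneda.obj (op C))

/-- The full subcategory `Tᶜ` of compact objects of `T`. -/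
abbrev Compacts (T : Type u) [Category.{v} T] [Preadditive T] : Type u :=
  (compactObjects T).FullSubcategory

/-- A `k`-linear functor `H : (Tᶜ)ᵒᵖ ⥤ Mod k` is cohomological if it sends every distinguished
triangle `X ⟶ Y ⟶ Z ⟶ X⟦1⟧` of `T` with compact vertices to an exact sequence
`H Z ⟶ H Y ⟶ H X`. -/
structure IsCohomological {k : Type w} [CommRing k] {T : Type u} [Category.{v} T]
    [HasZeroObject T] [HasShift T ℤ] [Preadditive T] [∀ n : ℤ, (shiftFunctor T n).Additive]
    [Pretriangulated T] [CategoryTheory.Linear k T]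
    (H : (Compacts T)ᵒᵖ ⥤ ModuleCat.{v} k) : Prop where
  additive : H.Additive
  map_smul : ∀ ⦃X Y : Compacts T⦄ (r : k) (f : X ⟶ Y), H.map (r • f).op = r • H.map f.op
  exact : ∀ ⦃X Y Z : Compacts T⦄ (f : X ⟶ Y) (g : Y ⟶ Z) (h : Z.obj ⟶ (X.obj)⟦(1 : ℤ)⟧),
    Triangle.mk f.hom g.hom h ∈ distTriang T →
      Function.Exact (H.map g.op) (H.map f.op)

/-- The restricted Yoneda functor, sending `X : T` to the functor `Hom(-, X)` on `Tᶜ`. -/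
def restrictedYoneda (k : Type w) [CommRing k] (T : Type u) [Category.{v} T] [Preadditive T]
    [CategoryTheory.Linear k T] : T ⥤ (Compacts T)ᵒᵖ ⥤ ModuleCat.{v} k :=
  linearYoneda k T ⋙
    (Functor.whiskeringLeft (Compacts T)ᵒᵖ Tᵒᵖ (ModuleCat.{v} k)).obj (compactObjects T).ι.op

end BrownAdams

/-!
A cohomological functor `H` on `Tᶜ` is flat, and flat functors on a countable category have
projective dimension at most one, although `H` itself may be as large as one likes. Here this takes
the form of a short exact sequence `0 ⟶ Hom(-, P) ⟶ Hom(-, P) ⟶ H ⟶ 0` with `P` a coproduct of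
compact objects (`IsCohomological.nonempty_resolution`). The map between the representable functors
comes from an endomorphism `R` of `P`, and if `X` is its cone, then the long exact sequence of
`Hom(C, -)` identifies `Hom(-, X)` with `H` on `Tᶜ` (`Resolution.exists_iso`); it breaks up into
short ones because `R` is also injective on maps from the desuspension of `C`. A transformation
`H ⟶ H'` lifts to the resolutions (`Resolution.exists_lift`), and the lift extends to the cones.

For the resolution, fix a sequence `G` of objects that represents all isomorphism classes of `Tᶜ`.
A subfunctor `S` of `H` is called pure if an element of `S` that extends along a morphism to an
element of `H` extends to an element of `S`. Then subquotients of pure subfunctors are again exact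
on triangles. Closing off an element under countably many operations shows that `H` is the union of
a well-ordered chain of pure subfunctors `S α` whose quotients by `⨆ β < α, S β` are countable
(`exists_pure_filtration`). A countable exact functor is the colimit of a sequence of representable
functors: biproducts adjoin elements, cones kill relations, and countably many such steps suffice
(`IsExactOn.nonempty_telescope`). So each quotient has the telescope `t - 1` of such a sequence as a
resolution. All these telescopes together act on one coproduct `P`, with one column for each `α`.
Elements of `H` are generated by columns, and the relations of column `α`, which hold only modulo
`⨆ β < α, S β`, are corrected by terms in the columns `< α`. The resulting `R = telescopeMap` is
triangular for the well-order, whence it is injective (`eq_zero_of_comp_telescopeMap_eq_zero`), and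
its image is the kernel of `Hom(-, P) ⟶ H` (`exists_comp_telescopeMap_eq_of_columns`).
-/

namespace BrownAdams

/-! ### Compact objects -/

section Compact

variable {T : Type u} [Category.{v} T] [Preadditive T] [HasCoproducts.{v} T]

open scoped Classical in
/-- The projection of a coproduct to a summand. -/
noncomputable def sigmaProj {J : Type v} (Y : J → T) (j : J) : ∐ Y ⟶ Y j :=
  Sigma.π Y j

@[simp]
lemma ι_sigmaProj {J : Type v} (Y : J → T) (j : J) :
    Sigma.ι Y j ≫ sigmaProj Y j = 𝟙 _ := by
  classical exact Sigma.ι_π_eq_id Y j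

@[simp]
lemma ι_sigmaProj_assoc {J : Type v} (Y : J → T) (j : J) {Z : T} (h : Y j ⟶ Z) :
    Sigma.ι Y j ≫ sigmaProj Y j ≫ h = h := by
  rw [← Category.assoc, ι_sigmaProj, Category.id_comp]

lemma ι_sigmaProj_of_ne {J : Type v} (Y : J → T) {i j : J} (h : i ≠ j) :
    Sigma.ι Y i ≫ sigmaProj Y j = 0 := by
  classical exact Sigma.ι_π_of_ne Y h

/-- Every morphism from `C` to a small coproduct is a finite sum of morphisms to the summands.
This is the elementary form of compactness; it determines the summands, since they are the
components of the morphism. -/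
def FactorsFinitely (C : T) : Prop :=
  ∀ ⦃J : Type v⦄ (Y : J → T) (f : C ⟶ ∐ Y),
    ∃ s : Finset J, ∑ j ∈ s, (f ≫ sigmaProj Y j) ≫ Sigma.ι Y j = f

lemma component_eq_zero_of_notMem {J : Type v} {Y : J → T} {C : T} {f : C ⟶ ∐ Y}
    {s : Finset J} (hs : ∑ j ∈ s, (f ≫ sigmaProj Y j) ≫ Sigma.ι Y j = f) {j : J} (hj : j ∉ s) :
    f ≫ sigmaProj Y j = 0 := by
  rw [← hs, Preadditive.sum_comp]
  refine Finset.sum_eq_zero fun i hi => ?_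
  rw [Category.assoc, ι_sigmaProj_of_ne, comp_zero]
  rintro rfl
  exact hj hi

lemma sum_components_of_subset {J : Type v} {Y : J → T} {C : T} {f : C ⟶ ∐ Y}
    {s s' : Finset J} (hs : ∑ j ∈ s, (f ≫ sigmaProj Y j) ≫ Sigma.ι Y j = f) (h : s ⊆ s') :
    ∑ j ∈ s', (f ≫ sigmaProj Y j) ≫ Sigma.ι Y j = f := by
  rw [← Finset.sum_subset h, hs]
  intro j _ hj
  rw [component_eq_zero_of_notMem hs hj, zero_comp]

lemma exists_sum_components_of_mem_closure {J : Type v} {Y : J → T} {C : T} {f : C ⟶ ∐ Y}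
    (hf : f ∈ AddSubgroup.closure {g | ∃ (j : J) (a : C ⟶ Y j), a ≫ Sigma.ι Y j = g}) :
    ∃ s : Finset J, ∑ j ∈ s, (f ≫ sigmaProj Y j) ≫ Sigma.ι Y j = f := by
  classical
  induction hf using AddSubgroup.closure_induction with
  | mem g hg =>
    obtain ⟨j, a, rfl⟩ := hg
    exact ⟨{j}, by simp⟩
  | zero => exact ⟨∅, by simp⟩
  | add f g _ _ hf hg =>
    obtain ⟨s, hs⟩ := hf
    obtain ⟨t, ht⟩ := hg
    refine ⟨s ∪ t, ?_⟩
    simp only [Preadditive.add_comp, Finset.sum_add_distrib]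
    rw [sum_components_of_subset hs Finset.subset_union_left,
      sum_components_of_subset ht Finset.subset_union_right]
  | neg f _ hf =>
    obtain ⟨s, hs⟩ := hf
    refine ⟨s, ?_⟩
    conv_rhs => rw [← hs]
    simp

/-- The group `Hom(C, ∐ Y)` is a coproduct of the `Hom(C, Y j)`, so the quotient by the subgroup
that their images generate vanishes. -/
lemma factorsFinitely_of_mem {C : T} (hC : compactObjects T C) : FactorsFinitely C := by
  intro J Y f
  have := hC J
  apply exists_sum_components_of_mem_closure
  let S := AddSubgroup.closure {g | ∃ (j : J) (a : C ⟶ Y j), a ≫ Sigma.ι Y j = g}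
  change f ∈ S
  let c := isColimitOfPreserves (preadditiveCoyoneda.obj (op C))
    (colimit.isColimit (Discrete.functor Y))
  have key : AddCommGrpCat.ofHom (QuotientAddGroup.mk' S) =
      (0 : AddCommGrpCat.of (C ⟶ ∐ Y) ⟶ AddCommGrpCat.of ((C ⟶ ∐ Y) ⧸ S)) := by
    refine c.hom_ext fun ⟨j⟩ => ?_
    ext a
    exact (QuotientAddGroup.eq_zero_iff _).2 (AddSubgroup.subset_closure ⟨j, a, rfl⟩)
  have := ConcreteCategory.congr_hom key f
  exact (QuotientAddGroup.eq_zero_iff _).1 this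

/-- The converse of `factorsFinitely_of_mem`: a cocone on the groups `Hom(C, Y j)` is extended to
`Hom(C, ∐ Y)` by summing over the components. -/
lemma mem_of_factorsFinitely {C : T} (hC : FactorsFinitely C) : compactObjects T C := by
  intro J
  let F := preadditiveCoyoneda.obj (op C)
  have : ∀ Y : J → T, PreservesColimit (Discrete.functor Y) F := by
    intro Y
    refine preservesColimit_of_preserves_colimit_cocone (colimit.isColimit (Discrete.functor Y)) ?_
    let a (s : Cocone (Discrete.functor Y ⋙ F)) (j : J) : (C ⟶ Y j) →+ s.pt :=
      (s.ι.app ⟨j⟩).hom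
    have hfin (s : Cocone (Discrete.functor Y ⋙ F)) (f : C ⟶ ∐ Y) :
        (Function.support fun j => a s j (f ≫ sigmaProj Y j)).Finite := by
      obtain ⟨t, ht⟩ := hC Y f
      refine t.finite_toSet.subset fun j hj => ?_
      by_contra hjt
      exact hj (by simp only [component_eq_zero_of_notMem ht hjt, map_zero])
    let d (s : Cocone (Discrete.functor Y ⋙ F)) : (C ⟶ ∐ Y) →+ s.pt := AddMonoidHom.mk'
      (fun f => ∑ᶠ j, a s j (f ≫ sigmaProj Y j)) (fun f g => by
        rw [← finsum_add_distrib (hfin s f) (hfin s g)]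
        simp only [Preadditive.add_comp, map_add])
    have hd (s : Cocone (Discrete.functor Y ⋙ F)) (j : J) (b : C ⟶ Y j) :
        d s (b ≫ Sigma.ι Y j) = a s j b := by
      change ∑ᶠ i, a s i ((b ≫ Sigma.ι Y j) ≫ sigmaProj Y i) = _
      rw [finsum_eq_single _ j]
      · simp
      · intro i hi
        rw [Category.assoc, ι_sigmaProj_of_ne _ hi.symm, comp_zero, map_zero]
    exact
      { desc := fun s => AddCommGrpCat.ofHom (d s)
        fac := fun s ⟨j⟩ => by
          ext a
          exact hd s j a
        uniq := fun s m hm => by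
          ext f
          obtain ⟨t, ht⟩ := hC Y f
          change m.hom f = d s f
          rw [← ht]
          refine (map_sum m.hom _ _).trans ((Finset.sum_congr rfl fun j _ => ?_).trans
            (map_sum (d s) _ _).symm)
          rw [hd]
          exact ConcreteCategory.congr_hom (hm ⟨j⟩) _ }
  exact preservesColimitsOfShape_of_discrete F

lemma compactObjects_biprod [HasBinaryBiproducts T] {A B : T} (hA : compactObjects T A)
    (hB : compactObjects T B) : compactObjects T (A ⊞ B) := by
  refine mem_of_factorsFinitely fun J Y f => exists_sum_components_of_mem_closure ?_
  obtain ⟨s, hs⟩ := factorsFinitely_of_mem hA Y (biprod.inl ≫ f)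
  obtain ⟨t, ht⟩ := factorsFinitely_of_mem hB Y (biprod.inr ≫ f)
  have : f = biprod.fst ≫ biprod.inl ≫ f + biprod.snd ≫ biprod.inr ≫ f := by
    rw [← Category.assoc, ← Category.assoc, ← Preadditive.add_comp, biprod.total, Category.id_comp]
  rw [this, ← hs, ← ht, Preadditive.comp_sum, Preadditive.comp_sum]
  refine add_mem (sum_mem fun j _ => ?_) (sum_mem fun j _ => ?_) <;>
  exact AddSubgroup.subset_closure ⟨j, _, Category.assoc _ _ _⟩

lemma compactObjects_of_isZero {Z : T} (hZ : IsZero Z) : compactObjects T Z :=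
  mem_of_factorsFinitely fun _ _ _ => ⟨∅, hZ.eq_of_src _ _⟩

end Compact

section CompactShift

variable {T : Type u} [Category.{v} T] [Preadditive T] [HasShift T ℤ]
  [∀ n : ℤ, (shiftFunctor T n).Additive]

/-- Since the shift is an equivalence, `Hom(C⟦n⟧, -)` is `Hom(C, -)` composed with a functor that
preserves coproducts. -/
lemma compactObjects_shift {C : T} (hC : compactObjects T C) (n : ℤ) :
    compactObjects T (C⟦n⟧) := by
  intro J
  have := hC J
  have : (shiftEquiv T n).functor.Additive := inferInstanceAs (shiftFunctor T n).Additive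
  let e : shiftFunctor T (-n) ⋙ preadditiveCoyoneda.obj (op C) ≅
      preadditiveCoyoneda.obj (op (C⟦n⟧)) :=
    NatIso.ofComponents
      (fun Y => AddEquiv.toAddCommGrpIso
        ((shiftEquiv T n).toAdjunction.homAddEquiv C Y).symm) (fun {Y Z} f => by
          ext a
          exact (shiftEquiv T n).toAdjunction.homEquiv_naturality_right_symm a f)
  exact preservesColimitsOfShape_of_natIso e

variable [HasZeroObject T] [Pretriangulated T] [HasCoproducts.{v} T]

/-- Let `z` be a morphism from the cone to a coproduct. The finitely many nonzero components of its
restriction to `Y` extend to the cone, and subtracting the extensions leaves a morphism that factors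
through the compact object `X⟦1⟧`. -/
lemma compactObjects_cone {X Y Z : T} {f : X ⟶ Y} {g : Y ⟶ Z} {h : Z ⟶ X⟦(1 : ℤ)⟧}
    (hT : Triangle.mk f g h ∈ distTriang T) (hX : compactObjects T X)
    (hY : compactObjects T Y) : compactObjects T Z := by
  refine mem_of_factorsFinitely fun J D z => exists_sum_components_of_mem_closure ?_
  obtain ⟨s, hs⟩ := factorsFinitely_of_mem hY D (g ≫ z)
  have hfg : f ≫ g = 0 := comp_distTriang_mor_zero₁₂ _ hT
  have hb (j : J) : ∃ b : Z ⟶ D j, (g ≫ z) ≫ sigmaProj D j = g ≫ b :=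
    Triangle.yoneda_exact₂ _ hT _ (by
      change f ≫ (g ≫ z) ≫ sigmaProj D j = 0
      rw [← Category.assoc, ← Category.assoc, hfg, zero_comp, zero_comp])
  choose b hb using hb
  obtain ⟨c, hc⟩ : ∃ c : X⟦(1 : ℤ)⟧ ⟶ ∐ D, z - ∑ j ∈ s, b j ≫ Sigma.ι D j = h ≫ c :=
    Triangle.yoneda_exact₃ _ hT _ (by
      change g ≫ (z - ∑ j ∈ s, b j ≫ Sigma.ι D j) = 0
      rw [Preadditive.comp_sub, Preadditive.comp_sum, sub_eq_zero]
      conv_lhs => rw [← hs]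
      exact Finset.sum_congr rfl fun j _ => by rw [hb, Category.assoc])
  obtain ⟨t, ht⟩ := factorsFinitely_of_mem (compactObjects_shift hX 1) D c
  rw [sub_eq_iff_eq_add] at hc
  rw [hc, ← ht, Preadditive.comp_sum]
  refine add_mem (sum_mem fun j _ => ?_) (sum_mem fun j _ => ?_)
  · exact AddSubgroup.subset_closure ⟨j, _, Category.assoc _ _ _⟩
  · exact AddSubgroup.subset_closure ⟨j, _, rfl⟩

end CompactShift

/-! ### Pure subfunctors -/

section Presheaf

variable {k : Type w} [CommRing k] {C : Type u} [Category.{v} C]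
  (H : Cᵒᵖ ⥤ ModuleCat.{v} k)

/-- The restriction map `H B → H A` along `f : A ⟶ B`, as a homomorphism of abelian groups. -/
def res {A B : C} (f : A ⟶ B) : H.obj (op B) →+ H.obj (op A) :=
  (H.map f.op).hom.toAddMonoidHom

lemma res_apply {A B : C} (f : A ⟶ B) (x : H.obj (op B)) : res H f x = H.map f.op x := rfl

@[simp]
lemma res_id {A : C} (x : H.obj (op A)) : res H (𝟙 A) x = x := by
  simp [res_apply]

lemma res_comp {A B D : C} (f : A ⟶ B) (g : B ⟶ D) (x : H.obj (op D)) :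
    res H (f ≫ g) x = res H f (res H g x) := by
  simp [res_apply]

variable (G : ℕ → C)

/-- A family of subgroups of the `H (G n)` is pure if it is stable under restriction and every
element of it that extends along some `G m ⟶ G n` to `H` extends within the family. -/
structure IsPure (S : ∀ n, AddSubgroup (H.obj (op (G n)))) : Prop where
  res_mem : ∀ {m n : ℕ} (f : G m ⟶ G n) {x}, x ∈ S n → res H f x ∈ S m
  exists_res_eq : ∀ {m n : ℕ} (f : G m ⟶ G n) (y), res H f y ∈ S m →
    ∃ y' ∈ S n, res H f y' = res H f y

variable {H G} in
/-- A pure family can be enlarged by a given element to a pure family, so that the quotient is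
countable: one closes the element under subtraction, restriction and a chosen solution,
modulo `S`, of each extension problem. -/
lemma IsPure.exists_countable_extension [∀ m n, Countable (G m ⟶ G n)]
    {S : ∀ n, AddSubgroup (H.obj (op (G n)))} (hS : IsPure H G S) (N : ℕ)
    (e : H.obj (op (G N))) :
    ∃ S' : ∀ n, AddSubgroup (H.obj (op (G n))), IsPure H G S' ∧ (∀ n, S n ≤ S' n) ∧ e ∈ S' N ∧
      ∃ R : ∀ n, Set (H.obj (op (G n))), ∀ n, (R n).Countable ∧ R n ⊆ S' n ∧
        ∀ y ∈ S' n, ∃ r ∈ R n, y - r ∈ S n := by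
  have hpick (m n : ℕ) (f : G m ⟶ G n) (x : H.obj (op (G m))) :
      ∃ p, ∀ y, res H f y - x ∈ S m → res H f p - x ∈ S m := by
    by_cases h : ∃ y, res H f y - x ∈ S m
    · exact ⟨h.choose, fun _ _ => h.choose_spec⟩
    · exact ⟨0, fun y hy => (h ⟨y, hy⟩).elim⟩
  choose pick hpick using hpick
  -- `step` applies each operation once, and `R i` is the result of `i` rounds.
  let step (R : ∀ n, Set (H.obj (op (G n)))) (n : ℕ) : Set (H.obj (op (G n))) :=
    R n ∪ Set.image2 (· - ·) (R n) (R n) ∪ (⋃ (m : ℕ) (f : G n ⟶ G m), res H f '' R m) ∪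
      ⋃ (m : ℕ) (f : G m ⟶ G n), pick m n f '' R m
  let R₀ (n : ℕ) : Set (H.obj (op (G n))) := {x | (⟨n, x⟩ : Σ n, H.obj (op (G n))) = ⟨N, e⟩ ∨ x = 0}
  let R (i : ℕ) : ∀ n, Set (H.obj (op (G n))) := step^[i] R₀
  have hRs (i : ℕ) : R (i + 1) = step (R i) := Function.iterate_succ_apply' _ _ _
  have hR (i n : ℕ) : (R i n).Countable := by
    induction i generalizing n with
    | zero =>
      refine Set.Countable.union ?_ (Set.countable_singleton 0)
      refine (Set.Subsingleton.countable fun x hx y hy => ?_)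
      exact eq_of_heq (Sigma.mk.inj (hx.trans hy.symm)).2
    | succ i ih =>
      rw [hRs]
      refine (((ih n).union ((ih n).image2 (ih n) _)).union ?_).union ?_ <;>
      exact Set.countable_iUnion fun m => Set.countable_iUnion fun f => (ih m).image _
  have hmono : ∀ n, Monotone fun i => R i n := fun n => monotone_nat_of_le_succ fun i => by
    rw [hRs]
    exact fun x hx => Or.inl (Or.inl (Or.inl hx))
  let U (n : ℕ) : Set (H.obj (op (G n))) := ⋃ i, R i n
  have hUsub {n : ℕ} {x y : H.obj (op (G n))} (hx : x ∈ U n) (hy : y ∈ U n) : x - y ∈ U n := by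
    obtain ⟨i, hi⟩ := Set.mem_iUnion.1 hx
    obtain ⟨j, hj⟩ := Set.mem_iUnion.1 hy
    refine Set.mem_iUnion.2 ⟨max i j + 1, ?_⟩
    rw [hRs]
    exact Or.inl (Or.inl (Or.inr ⟨x, hmono n (le_max_left i j) hi, y,
      hmono n (le_max_right i j) hj, rfl⟩))
  have hUres {m n : ℕ} (f : G m ⟶ G n) {x} (hx : x ∈ U n) : res H f x ∈ U m := by
    obtain ⟨i, hi⟩ := Set.mem_iUnion.1 hx
    refine Set.mem_iUnion.2 ⟨i + 1, ?_⟩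
    rw [hRs]
    exact Or.inl (Or.inr (Set.mem_iUnion₂.2 ⟨n, f, x, hi, rfl⟩))
  have hUpick {m n : ℕ} (f : G m ⟶ G n) {x} (hx : x ∈ U m) : pick m n f x ∈ U n := by
    obtain ⟨i, hi⟩ := Set.mem_iUnion.1 hx
    refine Set.mem_iUnion.2 ⟨i + 1, ?_⟩
    rw [hRs]
    exact Or.inr (Set.mem_iUnion₂.2 ⟨m, f, x, hi, rfl⟩)
  have hU0 (n : ℕ) : (0 : H.obj (op (G n))) ∈ U n := Set.mem_iUnion.2 ⟨0, Or.inr rfl⟩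
  let S' (n : ℕ) : AddSubgroup (H.obj (op (G n))) := AddSubgroup.ofSub {y | ∃ r ∈ U n, y - r ∈ S n}
    ⟨0, 0, hU0 n, by simp⟩ (by
      rintro x ⟨r, hr, hxr⟩ y ⟨s, hs, hys⟩
      refine ⟨r - s, hUsub hr hs, ?_⟩
      rw [← sub_eq_add_neg, sub_sub_sub_comm]
      exact sub_mem hxr hys)
  refine ⟨S', ⟨?_, ?_⟩, fun n x hx => ⟨0, hU0 n, by simpa using hx⟩,
    ⟨e, Set.mem_iUnion.2 ⟨0, Or.inl rfl⟩, by simp⟩, U, fun n =>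
    ⟨Set.countable_iUnion fun i => hR i n, fun r hr => ⟨r, hr, by simp⟩, fun y hy => hy⟩⟩
  · rintro m n f x ⟨r, hr, hxr⟩
    exact ⟨res H f r, hUres f hr, by rw [← map_sub]; exact hS.res_mem f hxr⟩
  · rintro m n f y ⟨r, hr, hyr⟩
    have hp := hpick m n f r y hyr
    obtain ⟨s, hs, hsf⟩ := hS.exists_res_eq f (y - pick m n f r) (by
      rw [map_sub, ← sub_sub_sub_cancel_right _ _ r]
      exact sub_mem hyr hp)
    refine ⟨s + pick m n f r, ⟨pick m n f r, hUpick f hr, by simpa using hs⟩, ?_⟩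
    rw [map_add, hsf, map_sub, sub_add_cancel]

variable [Preadditive C]

/-- The properties of a cohomological functor that only involve the objects `G n`: these have
binary biproducts and weak cokernels, and `H` is exact on the latter. -/
structure IsExactOn : Prop where
  exists_biprod : ∀ m n : ℕ, ∃ (b : ℕ) (i₁ : G m ⟶ G b) (i₂ : G n ⟶ G b)
    (p₁ : G b ⟶ G m) (p₂ : G b ⟶ G n),
    i₁ ≫ p₁ = 𝟙 _ ∧ i₁ ≫ p₂ = 0 ∧ i₂ ≫ p₁ = 0 ∧ i₂ ≫ p₂ = 𝟙 _
  exists_weakCokernel : ∀ {m n : ℕ} (f : G m ⟶ G n), ∃ (z : ℕ) (g : G n ⟶ G z),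
    f ≫ g = 0 ∧ ∀ y, res H f y = 0 → ∃ y', res H g y' = y

variable {H G} in
/-- The quotient `S' / S` of pure families is exact on weak cokernels. -/
lemma IsExactOn.exists_weakCokernel_rel (hH : IsExactOn H G)
    {S S' : ∀ n, AddSubgroup (H.obj (op (G n)))} (hS : IsPure H G S) (hS' : IsPure H G S')
    (hle : ∀ n, S n ≤ S' n) {m n : ℕ} (f : G m ⟶ G n) {y : H.obj (op (G n))} (hy : y ∈ S' n)
    (hfy : res H f y ∈ S m) :
    ∃ (z : ℕ) (g : G n ⟶ G z), f ≫ g = 0 ∧ ∃ y' ∈ S' z, res H g y' - y ∈ S n := by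
  obtain ⟨z, g, hfg, hg⟩ := hH.exists_weakCokernel f
  obtain ⟨s, hs, hsf⟩ := hS.exists_res_eq f y hfy
  obtain ⟨w, hw⟩ := hg (y - s) (by rw [map_sub, hsf, sub_self])
  obtain ⟨w', hw', hww'⟩ := hS'.exists_res_eq g w (by rw [hw]; exact sub_mem hy (hle n hs))
  refine ⟨z, g, hfg, w', hw', ?_⟩
  rw [hww', hw, sub_sub_cancel_left]
  exact neg_mem hs

variable [H.Additive]

/-- Restriction as a biadditive map. -/
def resHom (A B : C) : (A ⟶ B) →+ H.obj (op B) →+ H.obj (op A) :=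
  AddMonoidHom.mk' (res H) fun f g => by
    ext x
    simp [res_apply, Functor.map_add]

lemma res_zero {A B : C} (x : H.obj (op B)) : res H (0 : A ⟶ B) x = 0 :=
  DFunLike.congr_fun (map_zero (resHom H A B)) x

end Presheaf

/-! ### Countable quotients as sequential colimits -/

section Telescope

/-- The composite `X i ⟶ X (i + d)` of the transition morphisms of a sequence. -/
def transition {C : Type u} [Category.{v} C] {X : ℕ → C} (t : ∀ i, X i ⟶ X (i + 1)) (i : ℕ) :
    ∀ d, X i ⟶ X (i + d)
  | 0 => 𝟙 _
  | d + 1 => transition t i d ≫ t (i + d)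

variable {k : Type w} [CommRing k] {C : Type u} [Category.{v} C]
  (H : Cᵒᵖ ⥤ ModuleCat.{v} k) (G : ℕ → C)

variable {H G} in
lemma res_transition_sub_mem {S : ∀ n, AddSubgroup (H.obj (op (G n)))} (hS : IsPure H G S)
    {c : ℕ → ℕ} {x : ∀ i, H.obj (op (G (c i)))} {t : ∀ i, G (c i) ⟶ G (c (i + 1))}
    (h : ∀ i, res H (t i) (x (i + 1)) - x i ∈ S (c i)) (i d : ℕ) :
    res H (transition (X := fun i => G (c i)) t i d) (x (i + d)) - x i ∈ S (c i) := by
  induction d with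
  | zero => simp [transition]
  | succ d ih =>
    have := add_mem (hS.res_mem (transition (X := fun i => G (c i)) t i d) (h (i + d))) ih
    rw [map_sub, sub_add_sub_cancel] at this
    rw [transition, res_comp]
    exact this

variable [Preadditive C]

/-- A presentation of the quotient `S' / S` as the colimit of a sequence of representable
functors `Hom(-, G (c i))`, given by the classes of elements `x i` of `S'`. -/
structure Telescope (S S' : ∀ n, AddSubgroup (H.obj (op (G n)))) where
  /-- The indices of the representing objects. -/
  c : ℕ → ℕ
  /-- The elements that define the maps from the representable functors. -/
  x : ∀ i, H.obj (op (G (c i)))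
  /-- The transition morphisms. -/
  t : ∀ i, G (c i) ⟶ G (c (i + 1))
  mem : ∀ i, x i ∈ S' (c i)
  compat : ∀ i, res H (t i) (x (i + 1)) - x i ∈ S (c i)
  exists_res : ∀ n, ∀ y ∈ S' n, ∃ (i : ℕ) (a : G n ⟶ G (c i)), res H a (x i) - y ∈ S n
  exists_comp_eq_zero : ∀ (i n : ℕ) (a : G n ⟶ G (c i)), res H a (x i) ∈ S n →
    ∃ d, a ≫ transition (X := fun i => G (c i)) t i d = 0

variable {H G} [H.Additive]

/-- The inductive step in the construction of a telescope: one relation `a` is killed by passing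
to its weak cokernel, and one element `r` is adjoined by adding a summand. -/
lemma IsExactOn.exists_step (hH : IsExactOn H G)
    {S S' : ∀ n, AddSubgroup (H.obj (op (G n)))} (hS : IsPure H G S) (hS' : IsPure H G S')
    (hle : ∀ n, S n ≤ S' n) (s r : Σ n, S' n) (a : Σ n, G n ⟶ G s.1) :
    ∃ (s' : Σ n, S' n) (t : G s.1 ⟶ G s'.1),
      res H t s'.2 - s.2 ∈ S s.1 ∧ (∃ b : G r.1 ⟶ G s'.1, res H b s'.2 - r.2 ∈ S r.1) ∧
      (res H a.2 s.2 ∈ S a.1 → a.2 ≫ t = 0) := by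
  obtain ⟨z, g, hg, y, hy, hys⟩ : ∃ (z : ℕ) (g : G s.1 ⟶ G z),
      (res H a.2 s.2 ∈ S a.1 → a.2 ≫ g = 0) ∧ ∃ y' ∈ S' z, res H g y' - s.2 ∈ S s.1 := by
    by_cases h : res H a.2 s.2 ∈ S a.1
    · obtain ⟨z, g, hg, h⟩ := hH.exists_weakCokernel_rel hS hS' hle a.2 s.2.2 h
      exact ⟨z, g, fun _ => hg, h⟩
    · exact ⟨s.1, 𝟙 _, fun h' => (h h').elim, s.2, s.2.2, by simp⟩
  obtain ⟨b, i₁, i₂, p₁, p₂, h₁₁, h₁₂, h₂₁, h₂₂⟩ := hH.exists_biprod z r.1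
  refine ⟨⟨b, res H p₁ y + res H p₂ r.2,
    add_mem (hS'.res_mem _ hy) (hS'.res_mem _ r.2.2)⟩, g ≫ i₁, ?_, ⟨i₂, ?_⟩, fun h => ?_⟩
  · dsimp only
    rw [res_comp, map_add, ← res_comp, ← res_comp, h₁₁, h₁₂, res_id, res_zero, add_zero]
    exact hys
  · dsimp only
    rw [map_add, ← res_comp, ← res_comp, h₂₁, h₂₂, res_id, res_zero, zero_add, sub_self]
    exact zero_mem _
  · rw [← Category.assoc, hg h, zero_comp]

/-- A countable quotient of pure families is the colimit of a sequence of representable functors.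
The stages carry a list of the relations that occurred so far, and all of them are killed in
turn. -/
lemma IsExactOn.nonempty_telescope [∀ m n, Countable (G m ⟶ G n)] (hH : IsExactOn H G)
    {S S' : ∀ n, AddSubgroup (H.obj (op (G n)))} (hS : IsPure H G S) (hS' : IsPure H G S')
    (hle : ∀ n, S n ≤ S' n)
    (hcount : ∃ R : ∀ n, Set (H.obj (op (G n))), ∀ n, (R n).Countable ∧ R n ⊆ S' n ∧
        ∀ y ∈ S' n, ∃ r ∈ R n, y - r ∈ S n) :
    Nonempty (Telescope H G S S') := by
  obtain ⟨R, hR⟩ := hcount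
  have hRc (n : ℕ) : Countable (R n) := (hR n).1.to_subtype
  obtain ⟨r, hr⟩ : ∃ r : ℕ → Σ n, S' n, ∀ n, ∀ y ∈ S' n, ∃ (j : ℕ) (s : S' n),
      r j = ⟨n, s⟩ ∧ (s : H.obj (op (G n))) - y ∈ S n := by
    have : Nonempty (Σ n, R n) := by
      obtain ⟨r, hr, -⟩ := (hR 0).2.2 0 (zero_mem _)
      exact ⟨0, r, hr⟩
    obtain ⟨q, hq⟩ := exists_surjective_nat (Σ n, R n)
    let incl : (Σ n, R n) → Σ n, S' n := fun p => ⟨p.1, p.2.1, (hR _).2.1 p.2.2⟩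
    refine ⟨fun j => incl (q j), fun n y hy => ?_⟩
    obtain ⟨s, hs, hys⟩ := (hR n).2.2 y hy
    obtain ⟨j, hj⟩ := hq ⟨n, s, hs⟩
    refine ⟨j, ⟨s, (hR n).2.1 hs⟩, congrArg incl hj, ?_⟩
    rw [← neg_sub]
    exact neg_mem hys
  have hen (c : ℕ) : ∃ q : ℕ → Σ n, (G n ⟶ G c), Function.Surjective q := by
    have : Nonempty (Σ n, (G n ⟶ G c)) := ⟨⟨c, 𝟙 _⟩⟩
    exact exists_surjective_nat _
  choose en hen using hen
  choose nx t ht hb hk using hH.exists_step hS hS' hle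
  -- A state carries the current element and, at place `(i, k)`, the image at the current stage of
  -- the `k`-th morphism to the `i`-th object. The relation killed at stage `j` is the one at
  -- place `Nat.unpair j`, which is at most `j` in the first coordinate.
  let State := Σ s : (Σ n, S' n), ℕ × ℕ → Σ n, (G n ⟶ G s.1)
  let next (j : ℕ) (s : State) : State :=
    ⟨nx s.1 (r j) (s.2 (Nat.unpair j)), fun p => if p.1 ≤ j then
      ⟨(s.2 p).1, (s.2 p).2 ≫ t s.1 (r j) (s.2 (Nat.unpair j))⟩ else en _ p.2⟩
  let st₀ : ℕ → State := fun n => Nat.rec ⟨⟨0, 0⟩, fun p => en _ p.2⟩ next n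
  obtain ⟨st, tr, hdiag, hold, htr, hbr, hkr⟩ : ∃ (st : ℕ → State)
      (tr : ∀ i, G (st i).1.1 ⟶ G (st (i + 1)).1.1),
      (∀ i l, (st i).2 (i, l) = en _ l) ∧
      (∀ i j l, i ≤ j → (st (j + 1)).2 (i, l) =
        ⟨((st j).2 (i, l)).1, ((st j).2 (i, l)).2 ≫ tr j⟩) ∧
      (∀ i, res H (tr i) (st (i + 1)).1.2 - (st i).1.2 ∈ S (st i).1.1) ∧
      (∀ i, ∃ b : G (r i).1 ⟶ G (st (i + 1)).1.1,
        res H b (st (i + 1)).1.2 - (r i).2 ∈ S (r i).1) ∧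
      (∀ i, res H ((st i).2 (Nat.unpair i)).2 (st i).1.2 ∈ S _ →
        ((st i).2 (Nat.unpair i)).2 ≫ tr i = 0) := by
    refine ⟨st₀, fun i => t _ _ _, fun i l => ?_, fun i j l hij => ?_, fun i => ht _ _ _,
      fun i => hb _ _ _, fun i => hk _ _ _⟩
    · cases i with
      | zero => rfl
      | succ i => exact if_neg (by simp)
    · exact if_pos hij
  let T := transition (X := fun i => G (st i).1.1) tr
  have hob (i d l : ℕ) : (st (i + d)).2 (i, l) = ⟨(en _ l).1, (en _ l).2 ≫ T i d⟩ := by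
    induction d with
    | zero =>
      refine (hdiag i l).trans ?_
      simp [T, transition]
    | succ d ih =>
      refine (hold i (i + d) l (Nat.le_add_right i d)).trans ?_
      rw [ih]
      simp [T, transition]
  refine ⟨⟨fun i => (st i).1.1, fun i => (st i).1.2, tr, fun i => (st i).1.2.2, htr, ?_, ?_⟩⟩
  · intro n y hy
    obtain ⟨j, s, hj, hsy⟩ := hr n y hy
    have hbj := hbr j
    rw [hj] at hbj
    obtain ⟨b, hb⟩ := hbj
    refine ⟨j + 1, b, ?_⟩
    have := add_mem hb hsy
    rwa [sub_add_sub_cancel] at this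
  · intro i n a ha
    obtain ⟨l, hl⟩ := hen _ ⟨n, a⟩
    obtain ⟨d, hd⟩ := Nat.exists_eq_add_of_le (Nat.left_le_pair i l)
    have hun : Nat.unpair (i + d) = (i, l) := by rw [← hd, Nat.unpair_pair]
    refine ⟨d + 1, ?_⟩
    have := hkr (i + d)
    rw [hun, hob, hl] at this
    dsimp only at this
    rw [transition, ← Category.assoc]
    refine this ?_
    rw [res_comp]
    have hT := add_mem (hS.res_mem a (res_transition_sub_mem (c := fun i => (st i).1.1)
      (x := fun i => (st i).1.2) hS htr i d)) ha
    rwa [map_sub, sub_add_cancel] at hT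

end Telescope

/-! ### The filtration of a functor by pure subfunctors -/

section Filtration

variable {k : Type w} [CommRing k] {C : Type u} [Category.{v} C]
  {H : Cᵒᵖ ⥤ ModuleCat.{v} k} {G : ℕ → C}

lemma eq_zero_or_exists_mem_of_mem_iSup {A W : Type v} [AddCommGroup A] [LinearOrder W]
    {S : W → AddSubgroup A} {α : W} (hS : MonotoneOn S (Set.Iio α)) {y : A}
    (hy : y ∈ ⨆ β : Set.Iio α, S β) : y = 0 ∨ ∃ β < α, y ∈ S β := by
  refine AddSubgroup.iSup_induction _ (C := fun y => y = 0 ∨ ∃ β < α, y ∈ S β) hy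
    (fun β x hx => Or.inr ⟨β, β.2, hx⟩) (Or.inl rfl) fun x y hx hy => ?_
  obtain rfl | ⟨β, hβ, hx⟩ := hx
  · rwa [zero_add]
  obtain rfl | ⟨γ, hγ, hy⟩ := hy
  · rw [add_zero]
    exact Or.inr ⟨β, hβ, hx⟩
  have hm : max β γ < α := max_lt hβ hγ
  exact Or.inr ⟨max β γ, hm,
    add_mem (hS hβ hm (le_max_left _ _) hx) (hS hγ hm (le_max_right _ _) hy)⟩

lemma isPure_iSup {W : Type v} [LinearOrder W] {S : W → ∀ n, AddSubgroup (H.obj (op (G n)))}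
    {α : W} (hmono : ∀ n, MonotoneOn (fun α => S α n) (Set.Iio α))
    (hS : ∀ β < α, IsPure H G (S β)) :
    IsPure H G fun n => ⨆ β : Set.Iio α, S β n := by
  have hle (β : W) (hβ : β < α) (n : ℕ) : S β n ≤ ⨆ β : Set.Iio α, S β n :=
    le_iSup (fun β : Set.Iio α => S β n) ⟨β, hβ⟩
  refine ⟨fun {m n} f x hx => ?_, fun {m n} f y hy => ?_⟩
  · obtain rfl | ⟨β, hβ, hx⟩ := eq_zero_or_exists_mem_of_mem_iSup (hmono n) hx
    · rw [map_zero]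
      exact zero_mem _
    · exact hle β hβ m ((hS β hβ).res_mem f hx)
  · obtain h0 | ⟨β, hβ, hy⟩ := eq_zero_or_exists_mem_of_mem_iSup (hmono m) hy
    · exact ⟨0, zero_mem _, by rw [h0, map_zero]⟩
    · obtain ⟨y', hy', h⟩ := (hS β hβ).exists_res_eq f y hy
      exact ⟨y', hle β hβ n hy', h⟩

variable (H G) in
/-- Any functor is exhausted by a well-ordered chain of pure families with countable successive
quotients. -/
lemma exists_pure_filtration [∀ m n, Countable (G m ⟶ G n)] :
    ∃ (W : Type v) (_ : LinearOrder W) (_ : WellFoundedLT W)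
      (S : W → ∀ n, AddSubgroup (H.obj (op (G n)))),
      (∀ α, IsPure H G (S α)) ∧ (∀ n, Monotone fun α => S α n) ∧
      (∀ α, ∃ R : ∀ n, Set (H.obj (op (G n))), ∀ n, (R n).Countable ∧ R n ⊆ S α n ∧
        ∀ y ∈ S α n, ∃ r ∈ R n, y - r ∈ ⨆ β : Set.Iio α, S β n) ∧
      (∀ n y, ∃ α, y ∈ S α n) := by
  obtain ⟨_, hwf⟩ := exists_wellFoundedLT (α := Σ n, H.obj (op (G n)))
  let Fam := ∀ n, AddSubgroup (H.obj (op (G n)))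
  have hN (L : Fam) (e : Σ n, H.obj (op (G n))) : ∃ S' : Fam, IsPure H G L →
      IsPure H G S' ∧ (∀ n, L n ≤ S' n) ∧ e.2 ∈ S' e.1 ∧
      ∃ R : ∀ n, Set (H.obj (op (G n))), ∀ n, (R n).Countable ∧ R n ⊆ S' n ∧
        ∀ y ∈ S' n, ∃ r ∈ R n, y - r ∈ L n := by
    by_cases hL : IsPure H G L
    · obtain ⟨S', h⟩ := hL.exists_countable_extension e.1 e.2
      exact ⟨S', fun _ => h⟩
    · exact ⟨L, fun h => (hL h).elim⟩
  choose N hN using hN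
  -- Stage `α` is obtained from the union of the lower stages by adjoining the element `α`.
  obtain ⟨S, hS⟩ : ∃ S : (Σ n, H.obj (op (G n))) → Fam,
      ∀ α, S α = N (fun n => ⨆ β : Set.Iio α, S β n) α :=
    ⟨hwf.wf.fix fun α S => N (fun n => ⨆ β : Set.Iio α, S β.1 β.2 n) α,
      fun α => hwf.wf.fix_eq _ α⟩
  have hpure (α) : IsPure H G (S α) ∧ IsPure H G (fun n => ⨆ β : Set.Iio α, S β n) := by
    induction α using hwf.wf.induction with
    | _ α ih =>
    have hlow : IsPure H G (fun n => ⨆ β : Set.Iio α, S β n) := by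
      refine isPure_iSup (fun n => ?_) fun β hβ => (ih β hβ).1
      refine monotoneOn_iff_forall_lt.2 fun γ _ β hβ hγβ => ?_
      have := (hN _ β (ih β hβ).2).2.1 n
      rw [← hS] at this
      exact (le_iSup (fun γ : Set.Iio β => S γ n) ⟨γ, hγβ⟩).trans this
    refine ⟨?_, hlow⟩
    rw [hS]
    exact (hN _ α hlow).1
  have hS' (α) := hN _ α (hpure α).2
  simp only [← hS] at hS'
  have hmono (n : ℕ) : Monotone fun α => S α n := by
    refine monotone_iff_forall_lt.2 fun β α hβ => ?_
    exact (le_iSup (fun β : Set.Iio α => S β n) ⟨β, hβ⟩).trans ((hS' α).2.1 n)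
  exact ⟨_, _, hwf, S, fun α => (hS' α).1, hmono, fun α => (hS' α).2.2.2,
    fun n y => ⟨⟨n, y⟩, (hS' ⟨n, y⟩).2.2.1⟩⟩

end Filtration

/-! ### Triangular endomorphisms of a coproduct -/

section TriangularMap

variable {T : Type u} [Category.{v} T] [Preadditive T] [HasCoproducts.{v} T]
  {W : Type v} {Y : W × ℕ → T}
  (t : ∀ (α : W) (i : ℕ), Y (α, i) ⟶ Y (α, i + 1)) (p : ∀ j, Y j ⟶ ∐ Y)

/-- The endomorphism of `∐ Y` that acts on each column `Y (α, -)` as a telescope `t - 1`, corrected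
by `p`. -/
noncomputable def telescopeMap : ∐ Y ⟶ ∐ Y :=
  Sigma.desc fun j => t j.1 j.2 ≫ Sigma.ι Y (j.1, j.2 + 1) - Sigma.ι Y j - p j

lemma ι_telescopeMap (j : W × ℕ) : Sigma.ι Y j ≫ telescopeMap t p =
    t j.1 j.2 ≫ Sigma.ι Y (j.1, j.2 + 1) - Sigma.ι Y j - p j := by
  simp [telescopeMap]

variable [LinearOrder W]

/-- The morphisms to `∐ Y` whose components in the columns `≥ α` vanish. -/
def below (A : T) (α : W) : AddSubgroup (A ⟶ ∐ Y) where
  carrier := {u | ∀ j : W × ℕ, α ≤ j.1 → u ≫ sigmaProj Y j = 0}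
  zero_mem' j _ := zero_comp
  add_mem' {u v} hu hv j hj := by rw [Preadditive.add_comp, hu j hj, hv j hj, add_zero]
  neg_mem' {u} hu j hj := by rw [Preadditive.neg_comp, hu j hj, neg_zero]

lemma comp_mem_below {A B : T} (f : A ⟶ B) {α : W} {u : B ⟶ ∐ Y} (hu : u ∈ below B α) :
    f ≫ u ∈ below A α := fun j hj => by rw [Category.assoc, hu j hj, comp_zero]

/-- A nonzero morphism from a compact object to `∐ Y` has a last nonzero column, and a first nonzero
entry in it. -/
lemma exists_leading_component {A : T} (hA : FactorsFinitely A) {u : A ⟶ ∐ Y} (hu : u ≠ 0) :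
    ∃ j₀ : W × ℕ, u ≫ sigmaProj Y j₀ ≠ 0 ∧ ∀ j, u ≫ sigmaProj Y j ≠ 0 →
      j.1 < j₀.1 ∨ j.1 = j₀.1 ∧ j₀.2 ≤ j.2 := by
  classical
  obtain ⟨s, hs⟩ := hA Y u
  have hne : (s.filter fun j => u ≫ sigmaProj Y j ≠ 0).Nonempty := by
    by_contra h
    rw [Finset.not_nonempty_iff_eq_empty, Finset.filter_eq_empty_iff] at h
    refine hu (hs.symm.trans (Finset.sum_eq_zero fun j hj => ?_))
    have h0 : u ≫ sigmaProj Y j = 0 := not_not.1 (h hj)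
    rw [h0, zero_comp]
  obtain ⟨j₀, hj₀, hmax⟩ := Finset.exists_max_image _
    (fun j : W × ℕ => toLex (j.1, OrderDual.toDual j.2)) hne
  refine ⟨j₀, (Finset.mem_filter.1 hj₀).2, fun j hj => ?_⟩
  have hjs : j ∈ s := by
    by_contra h
    exact hj (component_eq_zero_of_notMem hs h)
  have := hmax j (Finset.mem_filter.2 ⟨hjs, hj⟩)
  rwa [Prod.Lex.toLex_le_toLex] at this

/-- The telescope map is injective on morphisms from compact objects: on a leading component it is
`-1`. -/
lemma eq_zero_of_comp_telescopeMap_eq_zero {p : ∀ j, Y j ⟶ ∐ Y}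
    (hp : ∀ j, p j ∈ below (Y j) j.1) {A : T} (hA : FactorsFinitely A) {u : A ⟶ ∐ Y}
    (hu : u ≫ telescopeMap t p = 0) : u = 0 := by
  by_contra hne
  obtain ⟨j₀, hj₀, hlead⟩ := exists_leading_component hA hne
  obtain ⟨s, hs⟩ := hA Y u
  refine hj₀ ?_
  have h : ∑ j ∈ s,
      (u ≫ sigmaProj Y j) ≫ (Sigma.ι Y j ≫ telescopeMap t p) ≫ sigmaProj Y j₀ = 0 := by
    have := congr($hu ≫ sigmaProj Y j₀)
    rw [← hs] at this
    simpa [Preadditive.sum_comp] using this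
  rw [Finset.sum_eq_single j₀] at h
  · have hnext : Sigma.ι Y (j₀.1, j₀.2 + 1) ≫ sigmaProj Y j₀ = 0 :=
      ι_sigmaProj_of_ne Y fun h => absurd (congrArg Prod.snd h) (Nat.succ_ne_self _)
    simpa [ι_telescopeMap, Preadditive.sub_comp, hnext, hp j₀ j₀ le_rfl] using h
  · intro j _ hj
    by_cases hj0 : u ≫ sigmaProj Y j = 0
    · rw [hj0, zero_comp]
    have hlej := hlead j hj0
    have hnext : Sigma.ι Y (j.1, j.2 + 1) ≫ sigmaProj Y j₀ = 0 := by
      refine ι_sigmaProj_of_ne Y ?_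
      rintro rfl
      rcases hlej with h | ⟨-, h⟩
      · exact lt_irrefl _ h
      · exact absurd h (by simp)
    simp [ι_telescopeMap, Preadditive.sub_comp, hnext, ι_sigmaProj_of_ne Y hj,
      hp j j₀ (hlej.elim le_of_lt fun h => h.1.le)]
  · intro hj
    rw [component_eq_zero_of_notMem hs hj, zero_comp]

/-- The morphisms that lie in the image of the telescope map up to columns `< α`. -/
noncomputable def imageModBelow (A : T) (p : ∀ j, Y j ⟶ ∐ Y) (α : W) : AddSubgroup (A ⟶ ∐ Y) :=
  (Preadditive.rightComp A (telescopeMap t p)).range ⊔ below A α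

lemma sub_mem_imageModBelow {p : ∀ j, Y j ⟶ ∐ Y}
    (hp : ∀ j, p j ∈ below (Y j) j.1) {A : T} {α : W} {i : ℕ} (b : A ⟶ Y (α, i)) :
    b ≫ Sigma.ι Y (α, i) - (b ≫ t α i) ≫ Sigma.ι Y (α, i + 1) ∈ imageModBelow t A p α := by
  refine AddSubgroup.mem_sup.2 ⟨(-(b ≫ Sigma.ι Y (α, i))) ≫ telescopeMap t p, ⟨_, rfl⟩,
    -(b ≫ p (α, i)), neg_mem (comp_mem_below b (hp (α, i))), ?_⟩
  rw [Preadditive.neg_comp, Category.assoc, ι_telescopeMap]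
  simp only [Preadditive.comp_sub, Category.assoc]
  abel

/-- Finitely many entries of a column can be moved down the telescope to a common place. -/
lemma exists_sub_mem_imageModBelow {p : ∀ j, Y j ⟶ ∐ Y}
    (hp : ∀ j, p j ∈ below (Y j) j.1) {A : T} {α : W} (b : ∀ i, A ⟶ Y (α, i)) (N : ℕ) :
    ∃ B : A ⟶ Y (α, N), ∑ i ∈ Finset.range N, b i ≫ Sigma.ι Y (α, i) - B ≫ Sigma.ι Y (α, N) ∈
      imageModBelow t A p α := by
  induction N with
  | zero => exact ⟨0, by simp⟩
  | succ N ih =>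
    obtain ⟨B, hB⟩ := ih
    refine ⟨(B + b N) ≫ t α N, ?_⟩
    have := add_mem hB (sub_mem_imageModBelow t hp (B + b N))
    convert this using 1
    rw [Finset.sum_range_succ]
    simp only [Preadditive.add_comp]
    abel

/-- Modulo columns `< α` and the image of the telescope map, a morphism with vanishing components in
the columns `> α` is concentrated in a single entry of column `α`. -/
lemma exists_entry_sub_mem_imageModBelow {p : ∀ j, Y j ⟶ ∐ Y}
    (hp : ∀ j, p j ∈ below (Y j) j.1) {A : T} (hA : FactorsFinitely A) {α : W} {u : A ⟶ ∐ Y}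
    (hu : ∀ j : W × ℕ, α < j.1 → u ≫ sigmaProj Y j = 0) :
    ∃ (N : ℕ) (B : A ⟶ Y (α, N)), u - B ≫ Sigma.ι Y (α, N) ∈ imageModBelow t A p α := by
  obtain ⟨s, hs⟩ := hA Y u
  obtain ⟨N, hN⟩ : ∃ N, ∀ j ∈ s, j.2 < N :=
    ⟨s.sup Prod.snd + 1, fun j hj => Nat.lt_succ_of_le (Finset.le_sup (f := Prod.snd) hj)⟩
  obtain ⟨B, hB⟩ := exists_sub_mem_imageModBelow t hp (fun i => u ≫ sigmaProj Y (α, i)) N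
  refine ⟨N, B, ?_⟩
  have hlow : u - ∑ i ∈ Finset.range N, (u ≫ sigmaProj Y (α, i)) ≫ Sigma.ι Y (α, i) ∈
      below A α := by
    rintro ⟨β, i⟩ (hβ : α ≤ β)
    rw [Preadditive.sub_comp, Preadditive.sum_comp, sub_eq_zero]
    simp only [Category.assoc]
    obtain rfl | hβ := hβ.eq_or_lt
    · by_cases hi : i < N
      · rw [Finset.sum_eq_single i]
        · simp
        · intro l _ hl
          rw [ι_sigmaProj_of_ne _ (fun h => hl (congrArg Prod.snd h)), comp_zero, comp_zero]
        · exact fun h => (h (Finset.mem_range.2 hi)).elim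
      · rw [component_eq_zero_of_notMem (j := (α, i)) hs fun h => hi (hN _ h), eq_comm]
        refine Finset.sum_eq_zero fun l hl => ?_
        rw [ι_sigmaProj_of_ne, comp_zero, comp_zero]
        intro h
        have hli : l = i := congrArg Prod.snd h
        exact hi (hli ▸ Finset.mem_range.1 hl)
    · rw [hu _ hβ, eq_comm]
      refine Finset.sum_eq_zero fun l hl => ?_
      rw [ι_sigmaProj_of_ne, comp_zero, comp_zero]
      exact fun h => hβ.ne (congrArg Prod.fst h)
  have := add_mem (AddSubgroup.mem_sup_right hlow : _ ∈ imageModBelow t A p α) hB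
  rwa [sub_add_sub_cancel] at this

end TriangularMap

/-! ### Resolutions by coproducts of compact objects -/

section Evaluation

variable {k : Type w} [CommRing k] {T : Type u} [Category.{v} T] [Preadditive T]
  [CategoryTheory.Linear k T] {H : (Compacts T)ᵒᵖ ⥤ ModuleCat.{v} k}

/-- The component at `A` of a transformation `Hom(-, X) ⟶ H`, as a homomorphism of abelian
groups. -/
def ev {X : T} (τ : (restrictedYoneda k T).obj X ⟶ H) (A : Compacts T) :
    (A.obj ⟶ X) →+ H.obj (op A) :=
  (τ.app (op A)).hom.toAddMonoidHom

lemma ev_comp {X : T} (τ : (restrictedYoneda k T).obj X ⟶ H) {A B : Compacts T} (f : A ⟶ B)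
    (u : B.obj ⟶ X) : ev τ A (f.hom ≫ u) = res H f (ev τ B u) :=
  ConcreteCategory.congr_hom (τ.naturality f.op) u

/-- The components of a transformation from the functor represented by a coproduct of compact
objects may be prescribed on the inclusions. -/
lemma exists_ev_ι_eq [HasCoproducts.{v} T] [H.Additive]
    (hsmul : ∀ ⦃X Y : Compacts T⦄ (r : k) (f : X ⟶ Y), H.map (r • f).op = r • H.map f.op)
    {J : Type v} (D : J → Compacts T) (d : ∀ j, H.obj (op (D j))) :
    ∃ τ : (restrictedYoneda k T).obj (∐ fun j => (D j).obj) ⟶ H,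
      ∀ j, ev τ (D j) (Sigma.ι (fun j => (D j).obj) j) = d j := by
  let Y := fun j => (D j).obj
  let comp (A : Compacts T) (j : J) : (A.obj ⟶ ∐ Y) →ₗ[k] H.obj (op A) :=
    { toFun := fun u => res H (ObjectProperty.homMk (u ≫ sigmaProj Y j) : A ⟶ D j) (d j)
      map_add' := fun u u' => by
        have : (ObjectProperty.homMk ((u + u') ≫ sigmaProj Y j) : A ⟶ D j) =
            ObjectProperty.homMk (u ≫ sigmaProj Y j) +
              ObjectProperty.homMk (u' ≫ sigmaProj Y j) := by
          ext
          exact Preadditive.add_comp _ _ _ _ _ _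
        rw [this]
        exact DFunLike.congr_fun (map_add (resHom H A (D j)) _ _) (d j)
      map_smul' := fun r u => by
        have : (ObjectProperty.homMk ((r • u) ≫ sigmaProj Y j) : A ⟶ D j) =
            r • ObjectProperty.homMk (u ≫ sigmaProj Y j) := by
          ext
          exact Linear.smul_comp _ _ _ _ _ _
        rw [this, res_apply, hsmul]
        rfl }
  have hfin (A : Compacts T) (u : A.obj ⟶ ∐ Y) : (Function.support fun j => comp A j u).Finite := by
    obtain ⟨s, hs⟩ := factorsFinitely_of_mem A.property Y u
    refine s.finite_toSet.subset fun j hj => ?_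
    by_contra h
    refine hj ?_
    have h0 := component_eq_zero_of_notMem hs h
    have : (ObjectProperty.homMk (u ≫ sigmaProj Y j) : A ⟶ D j) = 0 := by
      ext
      exact h0
    change res H (ObjectProperty.homMk (u ≫ sigmaProj Y j) : A ⟶ D j) (d j) = 0
    rw [this, res_zero]
  let total (A : Compacts T) : (A.obj ⟶ ∐ Y) →ₗ[k] H.obj (op A) :=
    { toFun := fun u => ∑ᶠ j, comp A j u
      map_add' := fun u u' => by
        simp only [map_add]
        exact finsum_add_distrib (hfin A u) (hfin A u')
      map_smul' := fun r u => by
        simp only [map_smul]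
        exact (smul_finsum' r (hfin A u)).symm }
  refine ⟨{ app := fun A => ModuleCat.ofHom (total A.unop), naturality := fun A B f => ?_ },
    fun j => ?_⟩
  · ext u
    change ∑ᶠ j, comp B.unop j (f.unop.hom ≫ u) = res H f.unop (∑ᶠ j, comp A.unop j u)
    rw [AddMonoidHom.map_finsum _ (hfin A.unop u)]
    refine finsum_congr fun j => ?_
    change res H _ _ = res H _ (res H _ _)
    rw [← res_comp]
    congr 2
    ext
    exact Category.assoc _ _ _
  · change ∑ᶠ i, comp (D j) i (Sigma.ι Y j) = d j
    rw [finsum_eq_single _ j]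
    · change res H (ObjectProperty.homMk (Sigma.ι Y j ≫ sigmaProj Y j) : D j ⟶ D j) (d j) = d j
      have : (ObjectProperty.homMk (Sigma.ι Y j ≫ sigmaProj Y j) : D j ⟶ D j) = 𝟙 _ := by
        ext
        exact ι_sigmaProj Y j
      rw [this, res_id]
    · intro i hi
      change res H (ObjectProperty.homMk (Sigma.ι Y j ≫ sigmaProj Y i) : D j ⟶ D i) (d i) = 0
      have : (ObjectProperty.homMk (Sigma.ι Y j ≫ sigmaProj Y i) : D j ⟶ D i) = 0 := by
        ext
        exact ι_sigmaProj_of_ne Y hi.symm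
      rw [this, res_zero]

end Evaluation

section Resolution

variable {k : Type w} [CommRing k] {T : Type u} [Category.{v} T] [Preadditive T]
  [HasCoproducts.{v} T]

variable {H : (Compacts T)ᵒᵖ ⥤ ModuleCat.{v} k} {G : ℕ → Compacts T} {W : Type v} [LinearOrder W]
  {S : W → ∀ n, AddSubgroup (H.obj (op (G n)))}
  (tel : ∀ α, Telescope H G (fun n => ⨆ β : Set.Iio α, S β n) (S α))

/-- The compact object in column `j.1` and row `j.2`. -/
abbrev entry (j : W × ℕ) : Compacts T := G ((tel j.1).c j.2)

/-- The object underlying `entry`. -/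
abbrev entryObj (j : W × ℕ) : T := (entry tel j).obj

variable {tel}

variable (tel) in
/-- The transition morphisms of the columns. -/
abbrev entryMap (α : W) (i : ℕ) : entry tel (α, i) ⟶ entry tel (α, i + 1) := (tel α).t i

variable (tel) in
/-- The morphisms underlying `entryMap`. -/
abbrev entryTrans (α : W) (i : ℕ) : entryObj tel (α, i) ⟶ entryObj tel (α, i + 1) :=
  (entryMap tel α i).hom

/-- Up to the image of the telescope map and lower columns, an entry of a column may be moved down
the telescope. -/
lemma sub_transition_mem_imageModBelow {p : ∀ j, entryObj tel j ⟶ ∐ entryObj tel}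
    (hp : ∀ j, p j ∈ below (entryObj tel j) j.1) {A : Compacts T} {α : W} {N : ℕ}
    (B : A ⟶ entry tel (α, N)) (d : ℕ) :
    B.hom ≫ Sigma.ι (entryObj tel) (α, N) -
      (B ≫ transition (X := fun i => entry tel (α, i)) (entryMap tel α) N d).hom ≫
        Sigma.ι (entryObj tel) (α, N + d) ∈ imageModBelow (entryTrans tel) A.obj p α := by
  induction d with
  | zero => simp [transition]
  | succ d ih =>
    have := add_mem ih (sub_mem_imageModBelow (entryTrans tel) hp
      (B ≫ transition (X := fun i => entry tel (α, i)) (entryMap tel α) N d).hom)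
    rw [sub_add_sub_cancel] at this
    rw [transition, ← Category.assoc]
    exact this

variable [CategoryTheory.Linear k T]

variable (H) in
/-- A short exact sequence `0 ⟶ Hom(-, P) ⟶ Hom(-, P) ⟶ H ⟶ 0` of functors on `Tᶜ`, where `P` is a
coproduct of compact objects. -/
structure Resolution where
  /-- The index type of the coproduct. -/
  J : Type v
  /-- The compact summands. -/
  D : J → Compacts T
  /-- The endomorphism of the coproduct that induces the injection. -/
  R : (∐ fun j => (D j).obj) ⟶ ∐ fun j => (D j).obj
  /-- The augmentation. -/
  τ : (restrictedYoneda k T).obj (∐ fun j => (D j).obj) ⟶ H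
  eq_zero : ∀ (A : Compacts T) (u : A.obj ⟶ _), u ≫ R = 0 → u = 0
  ev_comp_eq_zero : ∀ (A : Compacts T) (u : A.obj ⟶ _), ev τ A (u ≫ R) = 0
  exists_comp_eq : ∀ (A : Compacts T) (u : A.obj ⟶ _), ev τ A u = 0 → ∃ v, v ≫ R = u
  exists_ev_eq : ∀ (A : Compacts T) (y : H.obj (op A)), ∃ u, ev τ A u = y

/-- If each `S β` with `β < α` is generated by the columns `≤ β`, then the union of these `S β` is
generated by the columns `< α`. -/
lemma exists_ev_eq_of_mem_iSup {τ : (restrictedYoneda k T).obj (∐ entryObj tel) ⟶ H}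
    (hmono : ∀ n, Monotone fun α => S α n) {α : W}
    (ih : ∀ β < α, ∀ n, ∀ y ∈ S β n, ∃ u : (G n).obj ⟶ ∐ entryObj tel,
      (∀ j : W × ℕ, β < j.1 → u ≫ sigmaProj _ j = 0) ∧ ev τ (G n) u = y)
    {n : ℕ} {y : H.obj (op (G n))} (hy : y ∈ ⨆ β : Set.Iio α, S β n) :
    ∃ u ∈ below (Y := entryObj tel) (G n).obj α, ev τ (G n) u = y := by
  obtain rfl | ⟨β, hβ, hy⟩ := eq_zero_or_exists_mem_of_mem_iSup ((hmono n).monotoneOn _) hy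
  · exact ⟨0, zero_mem _, map_zero _⟩
  · obtain ⟨u, hu, huy⟩ := ih β hβ n y hy
    exact ⟨u, fun j hj => hu j (hβ.trans_le hj), huy⟩

/-- The columns `≤ α` generate `S α`: an element is hit by column `α` up to an element of the lower
stages. -/
lemma exists_ev_eq_of_mem [WellFoundedLT W] {τ : (restrictedYoneda k T).obj (∐ entryObj tel) ⟶ H}
    (hτ : ∀ j, ev τ (entry tel j) (Sigma.ι (entryObj tel) j) = (tel j.1).x j.2)
    (hmono : ∀ n, Monotone fun α => S α n) (α : W) :
    ∀ n, ∀ y ∈ S α n, ∃ u : (G n).obj ⟶ ∐ entryObj tel,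
      (∀ j : W × ℕ, α < j.1 → u ≫ sigmaProj _ j = 0) ∧ ev τ (G n) u = y := by
  induction α using WellFoundedLT.induction with
  | _ α ih =>
  intro n y hy
  obtain ⟨i, a, ha⟩ := (tel α).exists_res n y hy
  obtain ⟨u, hu, huy⟩ := exists_ev_eq_of_mem_iSup hmono ih ha
  refine ⟨a.hom ≫ Sigma.ι (entryObj tel) (α, i) - u, fun j hj => ?_, ?_⟩
  · rw [Preadditive.sub_comp, hu j hj.le, Category.assoc, ι_sigmaProj_of_ne, comp_zero, sub_zero]
    exact fun h => hj.ne (congrArg Prod.fst h)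
  · have := ev_comp τ (B := entry tel (α, i)) a (Sigma.ι (entryObj tel) (α, i))
    rw [map_sub, huy, this, hτ, sub_sub_cancel]

/-- The columns `< α` are mapped to the union of the lower stages. -/
lemma ev_mem_iSup {τ : (restrictedYoneda k T).obj (∐ entryObj tel) ⟶ H}
    (hτ : ∀ j, ev τ (entry tel j) (Sigma.ι (entryObj tel) j) = (tel j.1).x j.2)
    (hpure : ∀ α, IsPure H G (S α)) {α : W} {n : ℕ} {u : (G n).obj ⟶ ∐ entryObj tel}
    (hu : u ∈ below (G n).obj α) : ev τ (G n) u ∈ ⨆ β : Set.Iio α, S β n := by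
  obtain ⟨s, hs⟩ := factorsFinitely_of_mem (G n).property _ u
  rw [← hs, map_sum]
  refine sum_mem fun j _ => ?_
  by_cases hj : α ≤ j.1
  · rw [hu j hj, zero_comp, map_zero]
    exact zero_mem _
  · have := ev_comp τ (ObjectProperty.homMk (u ≫ sigmaProj _ j) : G n ⟶ entry tel j)
      (Sigma.ι (entryObj tel) j)
    rw [hτ] at this
    refine (le_iSup (fun β : Set.Iio α => S β n) ⟨j.1, not_le.1 hj⟩ : _) ?_
    erw [this]
    exact (hpure j.1).res_mem _ ((tel j.1).mem j.2)

/-- If the correction terms `p` are lifts of the errors `x (i + 1) ∘ t - x i` of the telescopes,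
then the telescope map takes values in the relations. -/
lemma ev_comp_telescopeMap {τ : (restrictedYoneda k T).obj (∐ entryObj tel) ⟶ H}
    (hτ : ∀ j, ev τ (entry tel j) (Sigma.ι (entryObj tel) j) = (tel j.1).x j.2)
    {p : ∀ j, entryObj tel j ⟶ ∐ entryObj tel}
    (hp : ∀ j, ev τ (entry tel j) (p j) =
      res H ((tel j.1).t j.2) ((tel j.1).x (j.2 + 1)) - (tel j.1).x j.2)
    (A : Compacts T) (u : A.obj ⟶ ∐ entryObj tel) :
    ev τ A (u ≫ telescopeMap (entryTrans tel) p) = 0 := by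
  obtain ⟨s, hs⟩ := factorsFinitely_of_mem A.property _ u
  rw [← hs, Preadditive.sum_comp, map_sum]
  refine Finset.sum_eq_zero fun j _ => ?_
  rw [Category.assoc]
  refine (ev_comp τ (ObjectProperty.homMk (u ≫ sigmaProj _ j) : A ⟶ entry tel j) _).trans ?_
  have h1 : ev τ (entry tel j)
      (Sigma.ι (entryObj tel) j ≫ telescopeMap (entryTrans tel) p) = 0 := by
    rw [ι_telescopeMap, map_sub, map_sub, hp, hτ]
    have := ev_comp τ (A := entry tel j) (B := entry tel (j.1, j.2 + 1)) ((tel j.1).t j.2)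
      (Sigma.ι (entryObj tel) (j.1, j.2 + 1))
    rw [hτ] at this
    erw [this]
    exact sub_self _
  rw [h1, map_zero]

/-- Relations that only involve the columns `≤ α` lie in the image of the telescope map. By
induction on `α` it suffices to remove column `α`. The relation can be concentrated in one entry of
this column; that entry is then a relation modulo the lower stages, so it is killed further down the
telescope. -/
lemma exists_comp_telescopeMap_eq_of_columns [WellFoundedLT W]
    {τ : (restrictedYoneda k T).obj (∐ entryObj tel) ⟶ H}
    (hτ : ∀ j, ev τ (entry tel j) (Sigma.ι (entryObj tel) j) = (tel j.1).x j.2)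
    (hpure : ∀ α, IsPure H G (S α))
    {p : ∀ j, entryObj tel j ⟶ ∐ entryObj tel} (hp : ∀ j, p j ∈ below (entryObj tel j) j.1)
    (hpev : ∀ j, ev τ (entry tel j) (p j) =
      res H ((tel j.1).t j.2) ((tel j.1).x (j.2 + 1)) - (tel j.1).x j.2)
    {n : ℕ} (α : W) : ∀ u : (G n).obj ⟶ ∐ entryObj tel,
      (∀ j : W × ℕ, α < j.1 → u ≫ sigmaProj _ j = 0) → ev τ (G n) u = 0 →
      ∃ v, v ≫ telescopeMap (entryTrans tel) p = u := by
  have hG := factorsFinitely_of_mem (G n).property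
  induction α using WellFoundedLT.induction with
  | _ α ih =>
  intro u hu hu0
  have hmem : u ∈ imageModBelow (entryTrans tel) (G n).obj p α := by
    obtain ⟨N, B, hB⟩ := exists_entry_sub_mem_imageModBelow (entryTrans tel) hp hG hu
    obtain ⟨_, ⟨v, rfl⟩, w, hw, h⟩ := AddSubgroup.mem_sup.1 hB
    let B' : G n ⟶ entry tel (α, N) := ObjectProperty.homMk B
    have hev : res H B' ((tel α).x N) = - ev τ (G n) w := by
      have h1 := ev_comp τ B' (Sigma.ι (entryObj tel) (α, N))
      rw [hτ] at h1
      have h2 := congr(ev τ (G n) $h)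
      have h3 : ev τ (G n) (v ≫ telescopeMap (entryTrans tel) p + w) =
        ev τ (G n) (u - B ≫ Sigma.ι (entryObj tel) (α, N)) := h2
      rw [map_add, map_sub, ev_comp_telescopeMap hτ hpev, hu0, zero_add, zero_sub] at h3
      rw [h3, neg_neg]
      exact h1.symm
    obtain ⟨d, hd⟩ := (tel α).exists_comp_eq_zero N n B' (by
      rw [hev]
      exact neg_mem (ev_mem_iSup hτ hpure hw))
    have := sub_transition_mem_imageModBelow hp B' d
    have hd' : B' ≫ transition (X := fun i => entry tel (α, i)) (entryMap tel α) N d = 0 := hd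
    rw [hd'] at this
    have h0 : (0 : G n ⟶ entry tel (α, N + d)).hom = 0 := rfl
    rw [h0, zero_comp, sub_zero] at this
    have hBι : B ≫ Sigma.ι (entryObj tel) (α, N) ∈ imageModBelow (entryTrans tel) _ p α := this
    simpa using add_mem hB hBι
  obtain ⟨_, ⟨v, rfl⟩, w, hw, h⟩ := AddSubgroup.mem_sup.1 hmem
  have hw0 : ev τ (G n) w = 0 := by
    have h3 : ev τ (G n) (v ≫ telescopeMap (entryTrans tel) p + w) = ev τ (G n) u :=
      congr(ev τ (G n) $h)
    rwa [map_add, ev_comp_telescopeMap hτ hpev, hu0, zero_add] at h3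
  obtain ⟨v', hv'⟩ : ∃ v', v' ≫ telescopeMap (entryTrans tel) p = w := by
    by_cases hne : w = 0
    · exact ⟨0, by rw [hne, zero_comp]⟩
    obtain ⟨j₀, hj₀, hlead⟩ := exists_leading_component hG hne
    refine ih j₀.1 (not_le.1 fun h => hj₀ (hw j₀ h)) w (fun j hj => ?_) hw0
    by_contra h
    exact (hlead j h).elim hj.not_gt fun h => hj.ne' h.1
  refine ⟨v + v', ?_⟩
  rw [Preadditive.add_comp, hv']
  exact h

/-- A functor that is exhausted by a well-ordered chain of pure families whose successive quotients
are sequential colimits of representable functors has a resolution. -/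
lemma nonempty_resolution_of_telescopes [H.Additive]
    (hsmul : ∀ ⦃X Y : Compacts T⦄ (r : k) (f : X ⟶ Y), H.map (r • f).op = r • H.map f.op)
    (hG : ∀ A : Compacts T, ∃ n, Nonempty (A ≅ G n)) [WellFoundedLT W]
    (hpure : ∀ α, IsPure H G (S α)) (hmono : ∀ n, Monotone fun α => S α n)
    (hexh : ∀ n y, ∃ α, y ∈ S α n)
    (tel : ∀ α, Telescope H G (fun n => ⨆ β : Set.Iio α, S β n) (S α)) :
    Nonempty (Resolution H) := by
  obtain ⟨τ, hτ⟩ := exists_ev_ι_eq hsmul (entry tel) (fun j => (tel j.1).x j.2)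
  change (restrictedYoneda k T).obj (∐ entryObj tel) ⟶ H at τ
  have hp (j : W × ℕ) := exists_ev_eq_of_mem_iSup (tel := tel) (τ := τ) hmono
    (fun β _ => exists_ev_eq_of_mem hτ hmono β) ((tel j.1).compat j.2)
  choose p hp hpev using hp
  refine ⟨⟨W × ℕ, entry tel, telescopeMap (entryTrans tel) p, τ, fun A u hu => ?_, fun A u => ?_,
    fun A u hu => ?_, fun A y => ?_⟩⟩
  · exact eq_zero_of_comp_telescopeMap_eq_zero _ hp (factorsFinitely_of_mem A.property) hu
  · exact ev_comp_telescopeMap hτ hpev A u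
  · obtain ⟨n, ⟨φ⟩⟩ := hG A
    have hφ : ev τ (G n) (φ.inv.hom ≫ u) = 0 := by rw [ev_comp, hu, map_zero]
    obtain ⟨v, hv⟩ : ∃ v, v ≫ telescopeMap (entryTrans tel) p = φ.inv.hom ≫ u := by
      by_cases hne : φ.inv.hom ≫ u = 0
      · exact ⟨0, by rw [hne, zero_comp]⟩
      obtain ⟨j₀, -, hlead⟩ := exists_leading_component
        (factorsFinitely_of_mem (G n).property) hne
      refine exists_comp_telescopeMap_eq_of_columns hτ hpure hp hpev j₀.1 _ (fun j hj => ?_) hφ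
      by_contra h
      exact (hlead j h).elim hj.not_gt fun h => hj.ne' h.1
    refine ⟨φ.hom.hom ≫ v, ?_⟩
    have hid : φ.hom.hom ≫ φ.inv.hom = 𝟙 A.obj := congr($(φ.hom_inv_id).hom)
    rw [Category.assoc, hv, ← Category.assoc, hid, Category.id_comp]
  · obtain ⟨n, ⟨φ⟩⟩ := hG A
    obtain ⟨α, hα⟩ := hexh n (res H φ.inv y)
    obtain ⟨u, -, hu⟩ := exists_ev_eq_of_mem hτ hmono α n _ hα
    refine ⟨φ.hom.hom ≫ u, ?_⟩
    rw [ev_comp, hu, ← res_comp, φ.hom_inv_id, res_id]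

end Resolution

/-! ### From resolutions to representing objects -/

section Countability

/-- A category whose skeleton has countably many arrows has a sequence of objects that represents
every isomorphism class, with countable sets of morphisms. -/
lemma exists_sequence_of_countable_skeleton {C : Type u} [Category.{v} C] [Nonempty C]
    (hcount : Countable (Arrow (Skeleton C))) :
    ∃ G : ℕ → C, (∀ m n, Countable (G m ⟶ G n)) ∧ ∀ A : C, ∃ n, Nonempty (A ≅ G n) := by
  have : Countable (Skeleton C) :=
    Function.Injective.countable (f := fun X : Skeleton C => Arrow.mk (𝟙 X))
      fun X Y h => congrArg (fun f : Arrow (Skeleton C) => f.left) h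
  have : Nonempty (Skeleton C) := ⟨toSkeleton (Classical.arbitrary C)⟩
  obtain ⟨g, hg⟩ := exists_surjective_nat (Skeleton C)
  refine ⟨fun n => (fromSkeleton C).obj (g n), fun m n => ?_, fun A => ?_⟩
  · have : Countable (g m ⟶ g n) := Function.Injective.countable (f := fun f => Arrow.mk f)
      fun f f' h => (Arrow.mk_inj _ _).1 h
    exact (fromSkeleton C).map_surjective.countable
  · obtain ⟨n, hn⟩ := hg (toSkeleton A)
    exact ⟨n, ⟨(fromSkeletonToSkeletonIso A).symm ≪≫ (fromSkeleton C).mapIso (eqToIso hn.symm)⟩⟩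

end Countability

section Comparison

/-- Two pointwise surjective transformations with the same kernel have isomorphic targets. -/
lemma exists_iso_of_surjective {k : Type w} [CommRing k] {C : Type u} [Category.{v} C]
    {F F₁ F₂ : C ⥤ ModuleCat.{v} k} (φ : F ⟶ F₁) (ψ : F ⟶ F₂)
    (hφ : ∀ A, Function.Surjective (φ.app A)) (hψ : ∀ A, Function.Surjective (ψ.app A))
    (h : ∀ A x, φ.app A x = 0 ↔ ψ.app A x = 0) :
    ∃ e : F₁ ≅ F₂, φ ≫ e.hom = ψ := by
  have hker (A : C) : LinearMap.ker (φ.app A).hom = LinearMap.ker (ψ.app A).hom := by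
    ext x
    exact h A x
  let e (A : C) : F₁.obj A ≃ₗ[k] F₂.obj A :=
    ((φ.app A).hom.quotKerEquivOfSurjective (hφ A)).symm ≪≫ₗ
      Submodule.quotEquivOfEq _ _ (hker A) ≪≫ₗ (ψ.app A).hom.quotKerEquivOfSurjective (hψ A)
  have he (A : C) (x : F.obj A) : e A (φ.app A x) = ψ.app A x := by
    have : ((φ.app A).hom.quotKerEquivOfSurjective (hφ A)).symm (φ.app A x) =
        Submodule.Quotient.mk x := by
      rw [LinearEquiv.symm_apply_eq]
      rfl
    change (ψ.app A).hom.quotKerEquivOfSurjective (hψ A) (Submodule.quotEquivOfEq _ _ (hker A)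
      (((φ.app A).hom.quotKerEquivOfSurjective (hφ A)).symm (φ.app A x))) = _
    rw [this]
    rfl
  refine ⟨NatIso.ofComponents (fun A => (e A).toModuleIso) fun {A B} f => ?_, ?_⟩
  · ext y
    obtain ⟨x, rfl⟩ := hφ A y
    change e B (F₁.map f (φ.app A x)) = F₂.map f (e A (φ.app A x))
    rw [he, ← NatTrans.naturality_apply, ← NatTrans.naturality_apply, he]
  · ext A x
    exact he A x

end Comparison

section Lifting

variable {k : Type w} [CommRing k] {T : Type u} [Category.{v} T] [Preadditive T]
  [CategoryTheory.Linear k T] [HasCoproducts.{v} T] {H : (Compacts T)ᵒᵖ ⥤ ModuleCat.{v} k}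

/-- A transformation lifts to the resolutions, since their terms are represented by coproducts of
compact objects and so behave like projective objects. -/
lemma Resolution.exists_lift {H' : (Compacts T)ᵒᵖ ⥤ ModuleCat.{v} k} (r : Resolution H)
    (r' : Resolution H') (α : H ⟶ H') :
    ∃ (g₀ g₁ : (∐ fun j => (r.D j).obj) ⟶ ∐ fun j => (r'.D j).obj),
      r.R ≫ g₀ = g₁ ≫ r'.R ∧ (restrictedYoneda k T).map g₀ ≫ r'.τ = r.τ ≫ α := by
  have h₀ (j : r.J) := r'.exists_ev_eq (r.D j)
    (α.app _ (ev r.τ (r.D j) (Sigma.ι (fun j => (r.D j).obj) j)))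
  choose a ha using h₀
  let g₀ := Sigma.desc a
  have hg₀ : (restrictedYoneda k T).map g₀ ≫ r'.τ = r.τ ≫ α := by
    ext A u
    change A.unop.obj ⟶ _ at u
    change ev r'.τ A.unop (u ≫ g₀) = ev (r.τ ≫ α) A.unop u
    obtain ⟨s, hs⟩ := factorsFinitely_of_mem A.unop.property _ u
    rw [← hs, Preadditive.sum_comp, map_sum, map_sum]
    refine Finset.sum_congr rfl fun j _ => ?_
    let b : A.unop ⟶ r.D j := ObjectProperty.homMk (u ≫ sigmaProj _ j)
    have h1 := ev_comp r'.τ b (a j)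
    have h2 := ev_comp (r.τ ≫ α) b (Sigma.ι (fun j => (r.D j).obj) j)
    refine Eq.trans ?_ (h1.trans (Eq.trans ?_ h2.symm))
    · rw [Category.assoc, Sigma.ι_desc]
      rfl
    · rw [ha]
      rfl
  have h₁ (j : r.J) : ∃ c : (r.D j).obj ⟶ ∐ fun j => (r'.D j).obj,
      c ≫ r'.R = (Sigma.ι (fun j => (r.D j).obj) j ≫ r.R) ≫ g₀ := by
    refine r'.exists_comp_eq (r.D j) _ ?_
    let y : (r.D j).obj ⟶ ∐ fun j => (r.D j).obj := Sigma.ι (fun j => (r.D j).obj) j ≫ r.R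
    have hy : ev ((restrictedYoneda k T).map g₀ ≫ r'.τ) (r.D j) y = ev (r.τ ≫ α) (r.D j) y := by
      rw [hg₀]
    refine Eq.trans hy ?_
    change α.app _ (ev r.τ (r.D j) (Sigma.ι (fun j => (r.D j).obj) j ≫ r.R)) = 0
    rw [r.ev_comp_eq_zero, map_zero]
  choose c hc using h₁
  refine ⟨g₀, Sigma.desc c, ?_, hg₀⟩
  ext j
  rw [Sigma.ι_desc_assoc, hc, Category.assoc]

end Lifting

section Triangulated

variable {k : Type w} [CommRing k] {T : Type u} [Category.{v} T]
  [HasZeroObject T] [HasShift T ℤ] [Preadditive T] [∀ n : ℤ, (shiftFunctor T n).Additive]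
  [Pretriangulated T] [CategoryTheory.Linear k T] [HasCoproducts.{v} T]
  {H : (Compacts T)ᵒᵖ ⥤ ModuleCat.{v} k}

/-- Binary biproducts and cones of compact objects are compact, and may be replaced by isomorphic
objects in the sequence `G`. -/
lemma IsCohomological.isExactOn (hH : IsCohomological H) {G : ℕ → Compacts T}
    (hG : ∀ A : Compacts T, ∃ n, Nonempty (A ≅ G n)) : IsExactOn H G := by
  refine ⟨fun m n => ?_, fun {m n} f => ?_⟩
  · have : HasBinaryBiproducts T := inferInstance
    let B : Compacts T :=
      ⟨(G m).obj ⊞ (G n).obj, compactObjects_biprod (G m).property (G n).property⟩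
    obtain ⟨b, ⟨φ⟩⟩ := hG B
    let i₁ : G m ⟶ B := ObjectProperty.homMk biprod.inl
    let i₂ : G n ⟶ B := ObjectProperty.homMk biprod.inr
    let p₁ : B ⟶ G m := ObjectProperty.homMk biprod.fst
    let p₂ : B ⟶ G n := ObjectProperty.homMk biprod.snd
    have h₁₁ : i₁ ≫ p₁ = 𝟙 _ := by ext; exact biprod.inl_fst
    have h₁₂ : i₁ ≫ p₂ = 0 := by ext; exact biprod.inl_snd
    have h₂₁ : i₂ ≫ p₁ = 0 := by ext; exact biprod.inr_fst
    have h₂₂ : i₂ ≫ p₂ = 𝟙 _ := by ext; exact biprod.inr_snd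
    exact ⟨b, i₁ ≫ φ.hom, i₂ ≫ φ.hom, φ.inv ≫ p₁, φ.inv ≫ p₂, by simpa, by simpa, by simpa,
      by simpa⟩
  · obtain ⟨Z, g, h, hT⟩ := distinguished_cocone_triangle f.hom
    let Z' : Compacts T := ⟨Z, compactObjects_cone hT (G m).property (G n).property⟩
    let g' : G n ⟶ Z' := ObjectProperty.homMk g
    obtain ⟨z, ⟨φ⟩⟩ := hG Z'
    refine ⟨z, g' ≫ φ.hom, ?_, fun y hy => ?_⟩
    · have : f ≫ g' = 0 := by
        ext
        exact comp_distTriang_mor_zero₁₂ _ hT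
      rw [← Category.assoc, this, zero_comp]
    · obtain ⟨y', hy'⟩ := (hH.exact f g' h hT y).1 hy
      refine ⟨res H φ.inv y', ?_⟩
      rw [← res_comp, Category.assoc, φ.hom_inv_id, Category.comp_id]
      exact hy'

/-- Cohomological functors have projective dimension at most one, if `Tᶜ` is essentially
countable. -/
theorem IsCohomological.nonempty_resolution (hH : IsCohomological H)
    (hcount : Countable (Arrow (Skeleton (Compacts T)))) : Nonempty (Resolution H) := by
  obtain ⟨Z, hZ⟩ := HasZeroObject.zero (C := T)
  have : Nonempty (Compacts T) := ⟨⟨Z, compactObjects_of_isZero hZ⟩⟩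
  obtain ⟨G, _, hG⟩ := exists_sequence_of_countable_skeleton hcount
  have := hH.additive
  obtain ⟨W, _, _, S, hpure, hmono, hS, hexh⟩ := exists_pure_filtration H G
  have htel (α : W) : Nonempty (Telescope H G (fun n => ⨆ β : Set.Iio α, S β n) (S α)) :=
    (hH.isExactOn hG).nonempty_telescope
      (isPure_iSup (fun n => (hmono n).monotoneOn _) fun β _ => hpure β) (hpure α)
      (fun n => iSup_le fun β => hmono n β.2.le) (hS α)
  exact nonempty_resolution_of_telescopes hH.map_smul hG hpure hmono hexh
    fun α => (htel α).some

/-- The cone of the map in a resolution represents the functor. Injectivity of that map on the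
shifts of compact objects makes the map from the coproduct to the cone surjective. -/
lemma Resolution.exists_iso (r : Resolution H) {X : T} {q : (∐ fun j => (r.D j).obj) ⟶ X}
    {δ : X ⟶ (∐ fun j => (r.D j).obj)⟦(1 : ℤ)⟧} (hT : Triangle.mk r.R q δ ∈ distTriang T) :
    ∃ e : (restrictedYoneda k T).obj X ≅ H, (restrictedYoneda k T).map q ≫ e.hom = r.τ := by
  refine exists_iso_of_surjective _ _ (fun A x => ?_) (fun A y => r.exists_ev_eq A.unop y)
    fun A u => ⟨fun hu => ?_, fun hu => ?_⟩
  · change A.unop.obj ⟶ X at x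
    -- The desuspension of `x ≫ δ` is killed by `R`.
    have hδ : x ≫ δ = 0 := by
      let A' : Compacts T :=
        ⟨A.unop.obj⟦(-1 : ℤ)⟧, compactObjects_shift A.unop.property (-1)⟩
      let ε : A'.obj⟦(1 : ℤ)⟧ ≅ A.unop.obj := (shiftEquiv T (1 : ℤ)).counitIso.app A.unop.obj
      obtain ⟨v, hv⟩ := (shiftFunctor T (1 : ℤ)).map_surjective (ε.hom ≫ x ≫ δ)
      have hv0 : v = 0 := by
        refine r.eq_zero A' v ((shiftFunctor T (1 : ℤ)).map_injective ?_)
        have h31 : δ ≫ r.R⟦(1 : ℤ)⟧' = 0 := comp_distTriang_mor_zero₃₁ _ hT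
        rw [Functor.map_comp, hv, Category.assoc, Category.assoc, h31, comp_zero, comp_zero,
          Functor.map_zero]
      rw [hv0, Functor.map_zero] at hv
      rw [← cancel_epi ε.hom, ← hv, comp_zero]
    obtain ⟨u, hu⟩ := Triangle.coyoneda_exact₃ _ hT x hδ
    exact ⟨u, hu.symm⟩
  · change A.unop.obj ⟶ _ at u
    obtain ⟨v, hv⟩ := Triangle.coyoneda_exact₂ _ hT u hu
    have hv' : u = v ≫ r.R := hv
    rw [hv']
    exact r.ev_comp_eq_zero A.unop v
  · change A.unop.obj ⟶ _ at u
    obtain ⟨v, rfl⟩ := r.exists_comp_eq A.unop u hu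
    have h0 : r.R ≫ q = 0 := comp_distTriang_mor_zero₁₂ _ hT
    change (v ≫ r.R) ≫ q = 0
    rw [Category.assoc, h0, comp_zero]

end Triangulated

end BrownAdams

theorem theorem8p10 {k : Type w} [CommRing k] {T : Type u} [Category.{v} T]
    [HasZeroObject T] [HasShift T ℤ] [Preadditive T] [∀ n : ℤ, (shiftFunctor T n).Additive]
    [Pretriangulated T] [IsTriangulated T]
    [CategoryTheory.Linear k T] [∀ n : ℤ, (shiftFunctor T n).Linear k]
    [HasCoproducts.{v} T]
    (hcount : Countable (Arrow (Skeleton (BrownAdams.Compacts T)))) :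
    (∀ H : (BrownAdams.Compacts T)ᵒᵖ ⥤ ModuleCat.{v} k, BrownAdams.IsCohomological H →
      ∃ X : T, Nonempty ((BrownAdams.restrictedYoneda k T).obj X ≅ H)) ∧
    (∀ H H' : (BrownAdams.Compacts T)ᵒᵖ ⥤ ModuleCat.{v} k,
      BrownAdams.IsCohomological H → BrownAdams.IsCohomological H' → ∀ α : H ⟶ H',
      ∃ (X X' : T) (f : X ⟶ X')
        (e : (BrownAdams.restrictedYoneda k T).obj X ≅ H)
        (e' : (BrownAdams.restrictedYoneda k T).obj X' ≅ H'),
        e.hom ≫ α = (BrownAdams.restrictedYoneda k T).map f ≫ e'.hom) := by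
  refine ⟨fun H hH => ?_, fun H H' hH hH' α => ?_⟩
  · obtain ⟨r⟩ := hH.nonempty_resolution hcount
    obtain ⟨X, q, δ, hT⟩ := distinguished_cocone_triangle r.R
    obtain ⟨e, -⟩ := r.exists_iso hT
    exact ⟨X, ⟨e⟩⟩
  · obtain ⟨r⟩ := hH.nonempty_resolution hcount
    obtain ⟨r'⟩ := hH'.nonempty_resolution hcount
    obtain ⟨X, q, δ, hT⟩ := distinguished_cocone_triangle r.R
    obtain ⟨X', q', δ', hT'⟩ := distinguished_cocone_triangle r'.R
    obtain ⟨e, he⟩ := r.exists_iso hT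
    obtain ⟨e', he'⟩ := r'.exists_iso hT'
    obtain ⟨g₀, g₁, hg, hg₀⟩ := r.exists_lift r' α
    obtain ⟨f, hf⟩ : ∃ f : X ⟶ X', q ≫ f = g₀ ≫ q' :=
      let ⟨f, hf, _⟩ := complete_distinguished_triangle_morphism _ _ hT hT' g₁ g₀ hg
      ⟨f, hf⟩
    refine ⟨X, X', f, e, e', ?_⟩
    -- Both sides agree after precomposition with the epimorphism induced by `q`.
    have hq : (BrownAdams.restrictedYoneda k T).map q ≫ e.hom ≫ α =
        (BrownAdams.restrictedYoneda k T).map q ≫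
          (BrownAdams.restrictedYoneda k T).map f ≫ e'.hom := by
      rw [← Category.assoc, he, ← Category.assoc, ← Functor.map_comp, hf, Functor.map_comp,
        Category.assoc, he', hg₀]
    ext A x
    obtain ⟨u, hu⟩ := r.exists_ev_eq A.unop (e.hom.app A x)
    have hx : ((BrownAdams.restrictedYoneda k T).map q).app A u = x := by
      apply (ConcreteCategory.bijective_of_isIso (e.hom.app A)).1
      rw [← hu]
      exact ConcreteCategory.congr_hom (NatTrans.congr_app he A) u
    rw [← hx]
    exact ConcreteCategory.congr_hom (NatTrans.congr_app hq A) u
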